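/- **Theorem 3.** Logarithms are to base 2 and all alphabets are finite. Let $p(y_1,y_2|x_1,x_2)$ be a discrete memoryless interference channel with input alphabets $\mathcal X_1,\mathcal X_2$ and output alphabets $\mathcal Y_1,\mathcal Y_2$. Let $\{U_{1,i}\}_{i\ge1}$ and $\{U_{2,i}\}_{i\ge1}$ be independent sources, each i.i.d. (with the laws of $U_1\in\mathcal U_1$ and $U_2\in\mathcal U_2$), and let $V_{k,i}=h_k(U_{k,i})$ for functions $h_k:\mathcal U_k\to\mathcal V_k$, $k=1,2$ (and $V_k=h_k(U_k)$). The sources *can be transmitted reliably* with side information $V_1$ at Receiver 2 and $V_2$ at Receiver 1 if there are encoders $f_k^n:\mathcal U_k^n\to\mathcal X_k^n$ ($k=1,2$) and decoders $g_1^n:\mathcal Y_1^n\times\mathcal V_2^n\to\mathcal U_1^n$ and $g_2^n:\mathcal Y_2^n\times\mathcal V_1^n\to\mathcal U_2^n$ for every $n$ such that $$\Pr\{(g_1^n(Y_1^n,V_2^n),\,g_2^n(Y_2^n,V_1^n))\neq(U_1^n,U_2^n)\}\to0\quad(n\to\infty),$$ where $(Y_1^n,Y_2^n)$ is the output of $n$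 uses of the channel with inputs $f_1^n(U_1^n)$, $f_2^n(U_2^n)$. In the *interference channel with message side information*, Transmitter $k$ sends messages $(W_{ks},W_{kp})$ to Receiver $k$, where Receiver 2 knows $W_{1s}$ and Receiver 1 knows $W_{2s}$. A rate quadruplet $(R_{1s},R_{1p},R_{2s},R_{2p})\in[0,\infty)^4$ is *achievable* if, for every $n$, there are encoders $(w_{ks},w_{kp})\mapsto x_k^n\in\mathcal X_k^n$ ($k=1,2$) and decoders $(y_1^n,w_{2s})\mapsto(\hat w_{1s},\hat w_{1p})$ and $(y_2^n,w_{1s})\mapsto(\hat w_{2s},\hat w_{2p})$, with message sets $\{1,\dots,\lceil 2^{nR_{ks}}\rceil\}$ and $\{1,\dots,\lceil 2^{nR_{kp}}\rceil\}$, such that the probability that at least one receiver errs, averaged uniformly over all message quadruplets, tends to $0$ as $n\to\infty$. The capacity region $\mathcal C_I\subseteq[0,\infty)^4$ is the closure of the set of achievable rate quadruplets. If $$(H(V_1),\,H(U_1|V_1),\,H(V_2),\,H(U_2|V_2))\in\operatorname{int}(\mathcal C_I),$$ where the interior is taken relative to $[0,\infty)^4$ (so that it contains the interior in $\mathbb R^4$),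 then the sources can be transmitted reliably. Conversely, if $(H(V_1),H(U_1|V_1),H(V_2),H(U_2|V_2))\notin\mathcal C_I$, then the sources cannot be transmitted reliably. -/

import Mathlib

open scoped NNReal Topology

namespace InterferenceChannel

/-! ### Entropies of finite random variables, in bits -/

/-- The Shannon entropy `H(A) = ∑ₐ p(a) log₂ (1 / p(a))` of a random variable with law `P`. -/
noncomputable def entropy {A : Type*} [Fintype A] (P : PMF A) : ℝ≥0 :=
  ⟨∑ a, (P a).toReal * Real.logb 2 (1 / (P a).toReal), by
    refine Finset.sum_nonneg fun a _ => ?_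
    rcases eq_or_lt_of_le (ENNReal.toReal_nonneg (a := P a)) with h | h
    · rw [← h, zero_mul]
    · refine mul_nonneg h.le (Real.logb_nonneg one_lt_two ?_)
      rw [le_div_iff₀ h, one_mul]
      exact ENNReal.toReal_le_of_le_ofReal zero_le_one (by simpa using P.coe_le_one a)⟩

/-- A joint probability is at most the corresponding marginal probability. -/
theorem joint_le_marginal {A B : Type*} (P : PMF (A × B)) (a : A) (b : B) :
    (P (a, b)).toReal ≤ (P.map Prod.snd b).toReal := by
  classical
  refine ENNReal.toReal_mono (PMF.apply_ne_top _ _) ?_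
  rw [PMF.map_apply]
  have h := ENNReal.le_tsum (f := fun x : A × B => if b = x.2 then P x else 0) (a, b)
  simpa using h

/-- The conditional entropy `H(A|B) = ∑ p(a, b) log₂ (1 / p(a|b))`, where `p(a|b) = p(a, b) / p(b)`,
of a pair of random variables `(A, B)` with joint law `P`. -/
noncomputable def condEntropy {A B : Type*} [Fintype A] [Fintype B] (P : PMF (A × B)) : ℝ≥0 :=
  ⟨∑ a, ∑ b, (P (a, b)).toReal *
      Real.logb 2 (1 / ((P (a, b)).toReal / (P.map Prod.snd b).toReal)), by
    refine Finset.sum_nonneg fun a _ => Finset.sum_nonneg fun b _ => ?_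
    rcases eq_or_lt_of_le (ENNReal.toReal_nonneg (a := P (a, b))) with h | h
    · rw [← h, zero_mul]
    · refine mul_nonneg h.le (Real.logb_nonneg one_lt_two ?_)
      rw [one_div_div, le_div_iff₀ h, one_mul]
      exact joint_le_marginal P a b⟩

/-! ### The discrete memoryless interference channel -/

/-- The transition law `p(y₁, y₂ | x₁, x₂)` of an interference channel. -/
abbrev Channel (X₁ X₂ Y₁ Y₂ : Type*) := X₁ → X₂ → PMF (Y₁ × Y₂)

/-- The probability that `n` memoryless uses of the channel with input sequences `x₁`, `x₂` give
the output sequences `y₁`, `y₂`. -/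
noncomputable def blockLaw {X₁ X₂ Y₁ Y₂ : Type*} (W : Channel X₁ X₂ Y₁ Y₂) {n : ℕ}
    (x₁ : Fin n → X₁) (x₂ : Fin n → X₂) (y₁ : Fin n → Y₁) (y₂ : Fin n → Y₂) : ℝ :=
  ∏ i, (W (x₁ i) (x₂ i) (y₁ i, y₂ i)).toReal

/-- The probability of a sequence of `n` i.i.d. letters with law `P`. -/
noncomputable def iidLaw {U : Type*} (P : PMF U) {n : ℕ} (u : Fin n → U) : ℝ :=
  ∏ i, (P (u i)).toReal

/-! ### Transmission of sources, with side information about the interfering source -/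

/-- Encoders and decoders of block length `n`: Receiver 1 observes `Y₁ⁿ` and `V₂ⁿ`, Receiver 2
observes `Y₂ⁿ` and `V₁ⁿ`. -/
structure SourceCode (U₁ V₁ U₂ V₂ X₁ X₂ Y₁ Y₂ : Type*) (n : ℕ) where
  /-- the encoder of Transmitter 1 -/
  enc₁ : (Fin n → U₁) → (Fin n → X₁)
  /-- the encoder of Transmitter 2 -/
  enc₂ : (Fin n → U₂) → (Fin n → X₂)
  /-- the decoder of Receiver 1 -/
  dec₁ : (Fin n → Y₁) → (Fin n → V₂) → (Fin n → U₁)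
  /-- the decoder of Receiver 2 -/
  dec₂ : (Fin n → Y₂) → (Fin n → V₁) → (Fin n → U₂)

open Classical in
/-- The probability that `(Û₁ⁿ, Û₂ⁿ) ≠ (U₁ⁿ, U₂ⁿ)`, for independent i.i.d. sources with letter laws
`P₁`, `P₂` and side information `V_{k,i} = h_k(U_{k,i})`. -/
noncomputable def SourceCode.errorProb {U₁ V₁ U₂ V₂ X₁ X₂ Y₁ Y₂ : Type*}
    [Fintype U₁] [Fintype U₂] [Fintype Y₁] [Fintype Y₂] {n : ℕ}
    (c : SourceCode U₁ V₁ U₂ V₂ X₁ X₂ Y₁ Y₂ n) (W : Channel X₁ X₂ Y₁ Y₂)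
    (P₁ : PMF U₁) (P₂ : PMF U₂) (h₁ : U₁ → V₁) (h₂ : U₂ → V₂) : ℝ :=
  ∑ u₁ : Fin n → U₁, ∑ u₂ : Fin n → U₂, iidLaw P₁ u₁ * iidLaw P₂ u₂ *
    ∑ y₁ : Fin n → Y₁, ∑ y₂ : Fin n → Y₂, blockLaw W (c.enc₁ u₁) (c.enc₂ u₂) y₁ y₂ *
      if c.dec₁ y₁ (fun i => h₂ (u₂ i)) ≠ u₁ ∨ c.dec₂ y₂ (fun i => h₁ (u₁ i)) ≠ u₂ then 1 else 0

/-- The sources can be transmitted reliably over the channel `W` with side information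
`V₁ = h₁(U₁)` at Receiver 2 and `V₂ = h₂(U₂)` at Receiver 1. -/
def ReliablyTransmissible {U₁ V₁ U₂ V₂ X₁ X₂ Y₁ Y₂ : Type*}
    [Fintype U₁] [Fintype U₂] [Fintype Y₁] [Fintype Y₂] (W : Channel X₁ X₂ Y₁ Y₂)
    (P₁ : PMF U₁) (P₂ : PMF U₂) (h₁ : U₁ → V₁) (h₂ : U₂ → V₂) : Prop :=
  ∃ c : (n : ℕ) → SourceCode U₁ V₁ U₂ V₂ X₁ X₂ Y₁ Y₂ n,
    Filter.Tendsto (fun n => (c n).errorProb W P₁ P₂ h₁ h₂) Filter.atTop (𝓝 0)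

/-! ### The interference channel with message side information -/

/-- A code of block length `n` with message sets of sizes `M₁s`, `M₁p`, `M₂s`, `M₂p`: Receiver 1
also knows the message `w₂s`, and Receiver 2 also knows the message `w₁s`. -/
structure MessageCode (X₁ X₂ Y₁ Y₂ : Type*) (n M₁s M₁p M₂s M₂p : ℕ) where
  /-- the encoder of Transmitter 1 -/
  enc₁ : Fin M₁s × Fin M₁p → (Fin n → X₁)
  /-- the encoder of Transmitter 2 -/
  enc₂ : Fin M₂s × Fin M₂p → (Fin n → X₂)
  /-- the decoder of Receiver 1 -/
  dec₁ : (Fin n → Y₁) → Fin M₂s → Fin M₁s × Fin M₁p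
  /-- the decoder of Receiver 2 -/
  dec₂ : (Fin n → Y₂) → Fin M₁s → Fin M₂s × Fin M₂p

open Classical in
/-- The average probability of error of a code. -/
noncomputable def MessageCode.errorProb {X₁ X₂ Y₁ Y₂ : Type*} [Fintype Y₁] [Fintype Y₂]
    {n M₁s M₁p M₂s M₂p : ℕ} (c : MessageCode X₁ X₂ Y₁ Y₂ n M₁s M₁p M₂s M₂p)
    (W : Channel X₁ X₂ Y₁ Y₂) : ℝ :=
  1 / ((M₁s : ℝ) * M₁p * M₂s * M₂p) *
    ∑ w₁ : Fin M₁s × Fin M₁p, ∑ w₂ : Fin M₂s × Fin M₂p,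
      ∑ y₁ : Fin n → Y₁, ∑ y₂ : Fin n → Y₂, blockLaw W (c.enc₁ w₁) (c.enc₂ w₂) y₁ y₂ *
        if c.dec₁ y₁ w₂.1 ≠ w₁ ∨ c.dec₂ y₂ w₁.1 ≠ w₂ then 1 else 0

/-- The size `⌈2^{nR}⌉` of a message set of rate `R` at block length `n`. -/
noncomputable def numMessages (n : ℕ) (R : ℝ≥0) : ℕ := ⌈(2 : ℝ) ^ ((n : ℝ) * (R : ℝ))⌉₊

/-- Rate quadruplets `(R₁s, R₁p, R₂s, R₂p)`, with the topology of `[0, ∞)⁴`. -/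
abbrev Rates := ℝ≥0 × ℝ≥0 × ℝ≥0 × ℝ≥0

/-- Achievable rate quadruplets. -/
def Achievable {X₁ X₂ Y₁ Y₂ : Type*} [Fintype Y₁] [Fintype Y₂] (W : Channel X₁ X₂ Y₁ Y₂) :
    Rates → Prop := fun (R₁s, R₁p, R₂s, R₂p) =>
  ∃ c : (n : ℕ) → MessageCode X₁ X₂ Y₁ Y₂ n
      (numMessages n R₁s) (numMessages n R₁p) (numMessages n R₂s) (numMessages n R₂p),
    Filter.Tendsto (fun n => (c n).errorProb W) Filter.atTop (𝓝 0)

/-- The capacity region of the interference channel with message side information: the closure of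
the set of achievable rate quadruplets. -/
def capacityRegion {X₁ X₂ Y₁ Y₂ : Type*} [Fintype Y₁] [Fintype Y₂] (W : Channel X₁ X₂ Y₁ Y₂) :
    Set Rates :=
  closure {R | Achievable W R}

/-- The point `(H(V₁), H(U₁|V₁), H(V₂), H(U₂|V₂))`, where `V_k = h_k(U_k)` and `U_k` has
law `P_k`. -/
noncomputable def entropyPoint {U₁ V₁ U₂ V₂ : Type*}
    [Fintype U₁] [Fintype V₁] [Fintype U₂] [Fintype V₂]
    (P₁ : PMF U₁) (P₂ : PMF U₂) (h₁ : U₁ → V₁) (h₂ : U₂ → V₂) : Rates :=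
  (entropy (P₁.map h₁), condEntropy (P₁.map fun u => (u, h₁ u)),
    entropy (P₂.map h₂), condEntropy (P₂.map fun u => (u, h₂ u)))

end InterferenceChannel

namespace InterferenceChannel

open Filter
open scoped Classical

/-! ### Probability laws on finite types -/

/-! Both directions turn one kind of code into the other at the same block length. No capacity
formula or Fano-type inequality enters.

Direct part. An interior point of the closure lies strictly below some achievable quadruplet. At
rates above the entropies, equipartition lets a source word be named by an index of its `V`-word
plus a second index given that word (`exists_source_encoding_seq`). These indices are not uniform,
while a message code is only good on average over uniform messages. A common shift of the indices in
the groups `Fin M` repairs this: averaged over all shifts the messages are uniform, so some fixed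
shift does as well (`IsLaw.exists_shift_le`). The first index depends on the `V`-word alone, so the
other receiver can compute the side information that the message code requires.

Converse, by contraposition. Given a good source code, messages are mapped to source words by a
random superposition codebook: `V`-words as cloud centres for the shared messages, and source words
drawn from the conditional law around them for the private ones. Each codeword has exactly the
source law (`sum_codebookLaw_mul`), so the mean error over codebooks is that of the source code,
plus the probability that a codeword is not unique. That probability vanishes at rates below the
entropies (`collisionProb_le`, `exists_tendsto_collision_bound`), so some fixed pair of codebooks
works. Every quadruplet strictly below the entropy point, up to zero coordinates, is therefore
achievable, and the entropy point lies in the closure. -/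

/-- A probability law on a finite type, as a real-valued mass function. -/
structure IsLaw {A : Type*} [Fintype A] (w : A → ℝ) : Prop where
  nonneg : ∀ a, 0 ≤ w a
  sum_eq_one : ∑ a, w a = 1

/-- The probability of an event. -/
noncomputable def mass {A : Type*} [Fintype A] (w : A → ℝ) (p : A → Prop) : ℝ :=
  ∑ a, w a * if p a then 1 else 0

section Laws

variable {A B : Type*} [Fintype A]

theorem isLaw_pmf (P : PMF A) : IsLaw fun a => (P a).toReal where
  nonneg _ := ENNReal.toReal_nonneg
  sum_eq_one := by
    rw [← ENNReal.toReal_sum fun a _ => P.apply_ne_top a]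
    have h := P.tsum_coe
    rw [tsum_fintype] at h
    rw [h, ENNReal.toReal_one]

theorem IsLaw.nonempty {w : A → ℝ} (hw : IsLaw w) : Nonempty A := by
  by_contra h
  rw [not_nonempty_iff] at h
  have := hw.sum_eq_one
  simp at this

theorem mass_nonneg {w : A → ℝ} (hw : IsLaw w) (p : A → Prop) : 0 ≤ mass w p :=
  Finset.sum_nonneg fun a _ => mul_nonneg (hw.nonneg a) (by split_ifs <;> norm_num)

/-- The implication is required only on the support because the facts fed in later (logarithms of
products, `h` of a codeword) can fail at points of probability zero. -/
theorem mass_mono {w : A → ℝ} (hw : IsLaw w) {p q : A → Prop}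
    (h : ∀ a, w a ≠ 0 → p a → q a) : mass w p ≤ mass w q := by
  refine Finset.sum_le_sum fun a _ => ?_
  by_cases h0 : w a = 0
  · simp [h0]
  · refine mul_le_mul_of_nonneg_left ?_ (hw.nonneg a)
    have := h a h0
    by_cases hp : p a
    · simp [hp, this hp]
    · simp only [hp, if_false]
      split_ifs <;> norm_num

theorem mass_or_le {w : A → ℝ} (hw : IsLaw w) (p q : A → Prop) :
    mass w (fun a => p a ∨ q a) ≤ mass w p + mass w q := by
  unfold mass
  rw [← Finset.sum_add_distrib]
  refine Finset.sum_le_sum fun a _ => ?_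
  rw [← mul_add]
  refine mul_le_mul_of_nonneg_left ?_ (hw.nonneg a)
  by_cases hp : p a <;> by_cases hq : q a <;> simp [hp, hq]

/-- A function takes a value at most its mean at a point of positive probability. -/
theorem IsLaw.exists_le_mean {w : A → ℝ} (hw : IsLaw w) (f : A → ℝ) :
    ∃ a, w a ≠ 0 ∧ f a ≤ ∑ b, w b * f b := by
  by_contra! h
  set m := ∑ b, w b * f b with hm
  obtain ⟨a, ha⟩ : ∃ a, w a ≠ 0 := by
    by_contra! h0
    have := hw.sum_eq_one
    simp [h0] at this
  have : ∑ b, w b * m < ∑ b, w b * f b := by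
    refine Finset.sum_lt_sum (fun b _ => ?_) ⟨a, Finset.mem_univ a, ?_⟩
    · by_cases h0 : w b = 0
      · simp [h0]
      · exact mul_le_mul_of_nonneg_left (h b h0).le (hw.nonneg b)
    · exact mul_lt_mul_of_pos_left (h a ha) (lt_of_le_of_ne (hw.nonneg a) (Ne.symm ha))
  rw [← Finset.sum_mul, hw.sum_eq_one, one_mul] at this
  exact lt_irrefl _ this

theorem IsLaw.prod [Fintype B] {w : A → ℝ} {w' : B → ℝ} (hw : IsLaw w) (hw' : IsLaw w') :
    IsLaw fun x : A × B => w x.1 * w' x.2 where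
  nonneg x := mul_nonneg (hw.nonneg _) (hw'.nonneg _)
  sum_eq_one := by
    rw [Fintype.sum_prod_type]
    simp only [← Finset.mul_sum, hw'.sum_eq_one, mul_one, hw.sum_eq_one]

/-- The law of the image under `h`. -/
noncomputable def marginal (w : A → ℝ) (h : A → B) (b : B) : ℝ := ∑ a, if h a = b then w a else 0

theorem sum_marginal_mul [Fintype B] (w : A → ℝ) (h : A → B) (f : B → ℝ) :
    ∑ b, marginal w h b * f b = ∑ a, w a * f (h a) := by
  simp only [marginal, Finset.sum_mul]
  rw [Finset.sum_comm]
  simp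

theorem isLaw_marginal [Fintype B] {w : A → ℝ} (hw : IsLaw w) (h : A → B) : IsLaw (marginal w h) where
  nonneg b := Finset.sum_nonneg fun a _ => by split_ifs <;> simp [hw.nonneg a]
  sum_eq_one := by simpa [hw.sum_eq_one] using sum_marginal_mul w h fun _ => 1

theorem IsLaw.le_marginal {w : A → ℝ} (hw : IsLaw w) (h : A → B) (a : A) :
    w a ≤ marginal w h (h a) := by
  refine le_trans (le_of_eq ?_) (Finset.single_le_sum
    (fun x _ => by split_ifs <;> simp [hw.nonneg x]) (Finset.mem_univ a))
  simp

theorem toReal_map_eq_marginal (P : PMF A) (h : A → B) (b : B) :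
    (P.map h b).toReal = marginal (fun a => (P a).toReal) h b := by
  rw [PMF.map_apply, tsum_fintype, ENNReal.toReal_sum]
  · refine Finset.sum_congr rfl fun a _ => ?_
    by_cases hb : h a = b
    · simp [hb]
    · simp [hb, Ne.symm hb]
  · intro a _
    split_ifs
    · exact P.apply_ne_top a
    · simp

end Laws

/-! ### Product laws -/

section Product

variable {ι A : Type*} [Fintype ι] [DecidableEq ι] [Fintype A]

/-- The law of independent random variables with laws `w i`. -/
noncomputable def piLaw (w : ι → A → ℝ) (z : ι → A) : ℝ := ∏ i, w i (z i)

theorem sum_pi_prod (F : ι → A → ℝ) : ∑ z : ι → A, ∏ i, F i (z i) = ∏ i, ∑ a, F i a := by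
  rw [Finset.prod_univ_sum, Fintype.piFinset_univ]

theorem isLaw_piLaw {w : ι → A → ℝ} (hw : ∀ i, IsLaw (w i)) : IsLaw (piLaw w) where
  nonneg z := Finset.prod_nonneg fun i _ => (hw i).nonneg _
  sum_eq_one := by
    unfold piLaw
    rw [sum_pi_prod]
    exact Finset.prod_eq_one fun i _ => (hw i).sum_eq_one

theorem sum_piLaw_mul {w : ι → A → ℝ} (hw : ∀ i, IsLaw (w i)) (i : ι) (f : A → ℝ) :
    ∑ z, piLaw w z * f (z i) = ∑ a, w i a * f a := by
  have h1 : ∀ z : ι → A, piLaw w z * f (z i) =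
      ∏ k, (w k (z k) * if k = i then f (z k) else 1) := by
    intro z
    rw [Finset.prod_mul_distrib, Finset.prod_ite_eq' Finset.univ i fun k => f (z k)]
    simp [piLaw]
  simp only [h1]
  rw [sum_pi_prod fun k a => w k a * if k = i then f a else 1, Finset.prod_eq_single i]
  · simp
  · intro k _ hk
    simp [hk, (hw k).sum_eq_one]
  · simp

/-- Padding the integrand with factors 1 at the other coordinates makes the sum factor, and each
padded coordinate contributes total mass 1. -/
theorem sum_piLaw_mul_mul {w : ι → A → ℝ} (hw : ∀ i, IsLaw (w i)) {i j : ι} (hij : i ≠ j)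
    (f g : A → ℝ) :
    ∑ z, piLaw w z * (f (z i) * g (z j)) = (∑ a, w i a * f a) * ∑ a, w j a * g a := by
  have h1 : ∀ z : ι → A, piLaw w z * (f (z i) * g (z j)) =
      ∏ k, (w k (z k) * ((if k = i then f (z k) else 1) * if k = j then g (z k) else 1)) := by
    intro z
    rw [Finset.prod_mul_distrib, Finset.prod_mul_distrib,
      Finset.prod_ite_eq' Finset.univ i fun k => f (z k),
      Finset.prod_ite_eq' Finset.univ j fun k => g (z k)]
    simp [piLaw]
  simp only [h1]
  rw [sum_pi_prod fun k a => w k a * ((if k = i then f a else 1) * if k = j then g a else 1),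
    Fintype.prod_eq_mul i j hij]
  · simp [hij, Ne.symm hij]
  · rintro k ⟨hi, hj⟩
    simp [hi, hj, (hw k).sum_eq_one]

/-- The probability that one of the variables `z j`, `j ∈ J`, equals the variable `z i` of the
same law. -/
theorem mass_piLaw_collision_le {w : ι → A → ℝ} (hw : ∀ i, IsLaw (w i)) {i : ι} {J : Finset ι}
    (hi : i ∉ J) (hJ : ∀ j ∈ J, w j = w i) {β : ℝ} (hβ : 0 ≤ β) :
    mass (piLaw w) (fun z => ∃ j ∈ J, z j = z i) ≤
      mass (w i) (fun a => β < w i a) + J.card * β := by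
  have hp := isLaw_piLaw hw
  -- Either the value of `z i` is itself likelier than `β`, or the union bound runs over `j` and
  -- over the common value `a`, whose probability is at most `β`.
  have hpt : ∀ z : ι → A, (if ∃ j ∈ J, z j = z i then (1 : ℝ) else 0) ≤
      (if β < w i (z i) then 1 else 0) +
        ∑ j ∈ J, ∑ a, (if w i a ≤ β ∧ z i = a then 1 else 0) * if z j = a then 1 else 0 := by
    intro z
    have hn : ∀ j ∈ J, (0 : ℝ) ≤
        ∑ a, (if w i a ≤ β ∧ z i = a then 1 else 0) * if z j = a then 1 else 0 := fun j _ =>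
      Finset.sum_nonneg fun a _ => mul_nonneg (by split_ifs <;> norm_num)
        (by split_ifs <;> norm_num)
    by_cases hb : β < w i (z i)
    · rw [if_pos hb]
      have := Finset.sum_nonneg hn
      split_ifs <;> linarith
    · rw [if_neg hb, zero_add]
      by_cases hc : ∃ j ∈ J, z j = z i
      · rw [if_pos hc]
        obtain ⟨j, hj, hji⟩ := hc
        refine le_trans ?_ (Finset.single_le_sum hn hj)
        refine le_trans ?_ (Finset.single_le_sum (fun a _ => mul_nonneg
          (by split_ifs <;> norm_num) (by split_ifs <;> norm_num)) (Finset.mem_univ (z i)))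
        simp [hji, not_lt.1 hb]
      · rw [if_neg hc]
        exact Finset.sum_nonneg hn
  calc mass (piLaw w) (fun z => ∃ j ∈ J, z j = z i)
      ≤ ∑ z, piLaw w z * ((if β < w i (z i) then 1 else 0) +
        ∑ j ∈ J, ∑ a, (if w i a ≤ β ∧ z i = a then 1 else 0) * if z j = a then 1 else 0) :=
        Finset.sum_le_sum fun z _ =>
          mul_le_mul_of_nonneg_left (le_trans (le_of_eq (by congr)) (hpt z)) (hp.nonneg z)
    _ = mass (w i) (fun a => β < w i a) + ∑ j ∈ J, ∑ a,
        ∑ z, piLaw w z * ((if w i a ≤ β ∧ z i = a then 1 else 0) * if z j = a then 1 else 0) := by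
        simp only [mul_add, Finset.sum_add_distrib, Finset.mul_sum]
        congr 1
        · exact sum_piLaw_mul hw i fun a => if β < w i a then 1 else 0
        · rw [Finset.sum_comm]
          exact Finset.sum_congr rfl fun j _ => Finset.sum_comm
    _ ≤ mass (w i) (fun a => β < w i a) + ∑ j ∈ J, β := by
        gcongr with j hj
        have hij : i ≠ j := fun h => hi (h ▸ hj)
        -- Independence of `z i` and `z j`; the factor `w j a = w i a` is at most `β` wherever the
        -- indicator survives.
        calc _ = ∑ a, (w i a * if w i a ≤ β then 1 else 0) * w j a := by
              refine Finset.sum_congr rfl fun a _ => ?_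
              rw [sum_piLaw_mul_mul hw hij (fun x => if w i a ≤ β ∧ x = a then 1 else 0)
                fun x => if x = a then 1 else 0]
              by_cases hb : w i a ≤ β <;> simp [hb]
          _ ≤ ∑ a, w i a * β := by
              refine Finset.sum_le_sum fun a _ => ?_
              rw [hJ j hj, mul_assoc]
              refine mul_le_mul_of_nonneg_left ?_ ((hw i).nonneg a)
              split_ifs with hb
              · simpa using hb
              · simpa using hβ
          _ = β := by rw [← Finset.sum_mul, (hw i).sum_eq_one, one_mul]
    _ = _ := by simp

end Product

/-! ### The weak law of large numbers -/

section LargeNumbers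

variable {U : Type*} [Fintype U]

theorem isLaw_iidLaw (P : PMF U) (n : ℕ) : IsLaw (iidLaw P : (Fin n → U) → ℝ) :=
  isLaw_piLaw fun _ => isLaw_pmf P

/-- Expanding the square, the off-diagonal terms vanish by independence and centring; only the `n`
diagonal ones remain. -/
theorem sum_iidLaw_mul_sq (P : PMF U) (g : U → ℝ) (hg : ∑ a, (P a).toReal * g a = 0) (n : ℕ) :
    ∑ u : Fin n → U, iidLaw P u * (∑ i, g (u i)) ^ 2 = n * ∑ a, (P a).toReal * g a ^ 2 := by
  have hw : ∀ _ : Fin n, IsLaw fun a => (P a).toReal := fun _ => isLaw_pmf P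
  have h1 : ∀ i j : Fin n, ∑ u : Fin n → U, iidLaw P u * (g (u i) * g (u j)) =
      if i = j then ∑ a, (P a).toReal * g a ^ 2 else 0 := by
    intro i j
    split_ifs with hij
    · subst hij
      simp only [← sq]
      exact sum_piLaw_mul hw i fun a => g a ^ 2
    · exact (sum_piLaw_mul_mul hw hij g g).trans (by rw [hg, zero_mul])
  calc _ = ∑ u : Fin n → U, ∑ i, ∑ j, iidLaw P u * (g (u i) * g (u j)) := by
        refine Finset.sum_congr rfl fun u _ => ?_
        rw [sq, Finset.sum_mul_sum]
        simp only [Finset.mul_sum]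
    _ = ∑ i : Fin n, ∑ j : Fin n, ∑ u : Fin n → U, iidLaw P u * (g (u i) * g (u j)) := by
        rw [Finset.sum_comm]
        exact Finset.sum_congr rfl fun i _ => Finset.sum_comm
    _ = _ := by simp [h1]

/-- The empirical mean exceeds a number larger than the mean with vanishing probability. -/
theorem tendsto_mass_le_sum (P : PMF U) (f : U → ℝ) {R : ℝ} (hR : ∑ a, (P a).toReal * f a < R) :
    Tendsto (fun n : ℕ => mass (iidLaw P : (Fin n → U) → ℝ) fun u => n * R ≤ ∑ i, f (u i))
      atTop (𝓝 0) := by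
  set μ := ∑ a, (P a).toReal * f a with hμ
  set σ := ∑ a, (P a).toReal * (f a - μ) ^ 2 with hσ
  have hδ : 0 < R - μ := by linarith
  have h0 : ∑ a, (P a).toReal * (f a - μ) = 0 := by
    simp only [mul_sub, Finset.sum_sub_distrib, ← Finset.sum_mul, (isLaw_pmf P).sum_eq_one]
    rw [← hμ, one_mul, sub_self]
  refine squeeze_zero' (Eventually.of_forall fun n => mass_nonneg (isLaw_iidLaw P n) _)
    (g := fun n : ℕ => σ / (R - μ) ^ 2 / n) ?_ (tendsto_const_div_atTop_nhds_zero_nat _)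
  filter_upwards [eventually_gt_atTop 0] with n hn
  have hn' : (0 : ℝ) < n := Nat.cast_pos.2 hn
  rw [div_div, le_div_iff₀ (by positivity)]
  -- Chebyshev: on the event the centred sum is at least `n * (R - μ)`, while its second moment is
  -- `n * σ`.
  have key : mass (iidLaw P : (Fin n → U) → ℝ) (fun u => n * R ≤ ∑ i, f (u i)) *
      (n * (R - μ)) ^ 2 ≤ n * σ := by
    rw [hσ, ← sum_iidLaw_mul_sq P (fun a => f a - μ) h0 n, mass, Finset.sum_mul]
    refine Finset.sum_le_sum fun u _ => ?_
    rw [mul_assoc]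
    refine mul_le_mul_of_nonneg_left ?_ ((isLaw_iidLaw P n).nonneg u)
    split_ifs with h
    · rw [one_mul]
      refine pow_le_pow_left₀ (by positivity) ?_ 2
      simp only [Finset.sum_sub_distrib, Finset.sum_const, Finset.card_univ, Fintype.card_fin,
        nsmul_eq_mul]
      linarith
    · rw [zero_mul]
      positivity
  refine le_of_mul_le_mul_left ?_ hn'
  linarith

theorem apply_ne_zero_of_iidLaw_ne_zero {U : Type*} {P : PMF U} {n : ℕ} {u : Fin n → U} (hu : iidLaw P u ≠ 0)
    (i : Fin n) : (P (u i)).toReal ≠ 0 :=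
  fun h => hu (Finset.prod_eq_zero (Finset.mem_univ i) h)

theorem sum_logb_one_div {n : ℕ} {r : Fin n → ℝ} (hr : ∀ i, 0 < r i) :
    ∑ i, Real.logb 2 (1 / r i) = -Real.logb 2 (∏ i, r i) := by
  rw [Real.logb_prod _ _ fun i _ => (hr i).ne', ← Finset.sum_neg_distrib]
  exact Finset.sum_congr rfl fun i _ => by rw [one_div, Real.logb_inv]

/-- The law of large numbers for `log (1 / r)`. Taking `r` to be the law of `h u`, or the
conditional probability of `u` given `h u`, gives the two forms of equipartition. -/
theorem tendsto_mass_prod_lt (P : PMF U) {r : U → ℝ} (hr : ∀ u, (P u).toReal ≠ 0 → 0 < r u)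
    {R : ℝ} (hR : ∑ a, (P a).toReal * Real.logb 2 (1 / r a) < R) :
    Tendsto (fun n : ℕ => mass (iidLaw P : (Fin n → U) → ℝ)
      fun u => ∏ i, r (u i) < (2 : ℝ) ^ (-(n * R))) atTop (𝓝 0) := by
  refine squeeze_zero (fun n => mass_nonneg (isLaw_iidLaw P n) _) (fun n => ?_)
    (tendsto_mass_le_sum P _ hR)
  refine mass_mono (isLaw_iidLaw P n) fun u hu h => ?_
  have hp : ∀ i, 0 < r (u i) := fun i => hr _ (apply_ne_zero_of_iidLaw_ne_zero hu i)
  rw [sum_logb_one_div hp]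
  have := (Real.logb_le_iff_le_rpow one_lt_two (Finset.prod_pos fun i _ => hp i)).2 h.le
  linarith

theorem tendsto_mass_lt_prod (P : PMF U) {r : U → ℝ} (hr : ∀ u, (P u).toReal ≠ 0 → 0 < r u)
    {R : ℝ} (hR : R < ∑ a, (P a).toReal * Real.logb 2 (1 / r a)) :
    Tendsto (fun n : ℕ => mass (iidLaw P : (Fin n → U) → ℝ)
      fun u => (2 : ℝ) ^ (-(n * R)) < ∏ i, r (u i)) atTop (𝓝 0) := by
  have hR' : ∑ a, (P a).toReal * -Real.logb 2 (1 / r a) < -R := by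
    simp only [mul_neg, Finset.sum_neg_distrib]
    linarith
  refine squeeze_zero (fun n => mass_nonneg (isLaw_iidLaw P n) _) (fun n => ?_)
    (tendsto_mass_le_sum P _ hR')
  refine mass_mono (isLaw_iidLaw P n) fun u hu h => ?_
  have hp : ∀ i, 0 < r (u i) := fun i => hr _ (apply_ne_zero_of_iidLaw_ne_zero hu i)
  rw [Finset.sum_neg_distrib, sum_logb_one_div hp]
  have := (Real.le_logb_iff_rpow_le one_lt_two (Finset.prod_pos fun i _ => hp i)).2 h.le
  linarith

end LargeNumbers

/-! ### Asymptotic equipartition -/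

section Equipartition

variable {U V : Type*} [Fintype U]

/-- The law of the sequence `h(u₁), …, h(uₙ)`. -/
theorem marginal_iidLaw (P : PMF U) (h : U → V) {n : ℕ} (v : Fin n → V) :
    marginal (iidLaw P : (Fin n → U) → ℝ) (fun u i => h (u i)) v = iidLaw (P.map h) v := by
  have h1 : marginal (iidLaw P : (Fin n → U) → ℝ) (fun u i => h (u i)) v =
      ∑ u : Fin n → U, ∏ i, if h (u i) = v i then (P (u i)).toReal else 0 := by
    refine Finset.sum_congr rfl fun u _ => ?_
    split_ifs with hu
    · refine Finset.prod_congr rfl fun i _ => ?_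
      rw [if_pos (congrFun hu i)]
    · obtain ⟨i, hi⟩ := Function.ne_iff.1 hu
      exact (Finset.prod_eq_zero (Finset.mem_univ i) (if_neg hi)).symm
  rw [h1, sum_pi_prod fun i a => if h a = v i then (P a).toReal else 0]
  exact Finset.prod_congr rfl fun i _ => (toReal_map_eq_marginal P h (v i)).symm

theorem map_apply_pos (P : PMF U) (h : U → V) (u : U) (hu : (P u).toReal ≠ 0) :
    0 < (P.map h (h u)).toReal := by
  rw [toReal_map_eq_marginal]
  exact ((isLaw_pmf P).nonneg u).lt_of_ne' hu |>.trans_le ((isLaw_pmf P).le_marginal h u)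

theorem iidLaw_div_iidLaw_map {U V : Type*} (P : PMF U) (h : U → V) {n : ℕ} (u : Fin n → U) :
    ∏ i, ((P (u i)).toReal / (P.map h (h (u i))).toReal) =
      iidLaw P u / iidLaw (P.map h) fun i => h (u i) :=
  Finset.prod_div_distrib ..

theorem iidLaw_map_pos (P : PMF U) (h : U → V) {n : ℕ} {u : Fin n → U} (hu : iidLaw P u ≠ 0) :
    0 < iidLaw (P.map h) fun i => h (u i) :=
  Finset.prod_pos fun i _ => map_apply_pos P h _ (apply_ne_zero_of_iidLaw_ne_zero hu i)

theorem condProb_pos (P : PMF U) (h : U → V) (u : U) (hu : (P u).toReal ≠ 0) :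
    0 < (P u).toReal / (P.map h (h u)).toReal :=
  div_pos (((isLaw_pmf P).nonneg u).lt_of_ne' hu) (map_apply_pos P h u hu)

variable [Fintype V]

theorem coe_entropy_map (P : PMF U) (h : U → V) : (entropy (P.map h) : ℝ) =
    ∑ u, (P u).toReal * Real.logb 2 (1 / (P.map h (h u)).toReal) := by
  change ∑ b, _ = _
  rw [← sum_marginal_mul (fun u => (P u).toReal) h fun b =>
    Real.logb 2 (1 / (P.map h b).toReal)]
  simp only [toReal_map_eq_marginal]

/-- The joint law lives on the graph of `h`, so only `b = h a` contributes to the inner sum. -/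
theorem coe_condEntropy_map (P : PMF U) (h : U → V) :
    (condEntropy (P.map fun u => (u, h u)) : ℝ) =
      ∑ u, (P u).toReal * Real.logb 2 (1 / ((P u).toReal / (P.map h (h u)).toReal)) := by
  change ∑ a, ∑ b, _ = _
  have hs : (P.map fun u => (u, h u)).map Prod.snd = P.map h := by
    rw [PMF.map_comp]; rfl
  have hj : ∀ a b, ((P.map fun u => (u, h u)) (a, b)).toReal =
      if b = h a then (P a).toReal else 0 := by
    intro a b
    rw [toReal_map_eq_marginal, marginal, Finset.sum_eq_single a]
    · simp [eq_comm]
    · intro x _ hx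
      simp [hx]
    · simp
  simp only [hs, hj]
  refine Finset.sum_congr rfl fun a _ => ?_
  rw [Finset.sum_eq_single (h a)]
  · simp
  · intro b _ hb
    simp [hb]
  · simp

theorem tendsto_mass_iidLaw_map_lt (P : PMF U) (h : U → V) {R : ℝ}
    (hR : entropy (P.map h) < R) :
    Tendsto (fun n : ℕ => mass (iidLaw P : (Fin n → U) → ℝ)
      fun u => iidLaw (P.map h) (fun i => h (u i)) < (2 : ℝ) ^ (-(n * R))) atTop (𝓝 0) :=
  tendsto_mass_prod_lt P (map_apply_pos P h) (by rwa [coe_entropy_map] at hR)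

theorem tendsto_mass_lt_iidLaw_map (P : PMF U) (h : U → V) {R : ℝ}
    (hR : R < entropy (P.map h)) :
    Tendsto (fun n : ℕ => mass (iidLaw P : (Fin n → U) → ℝ)
      fun u => (2 : ℝ) ^ (-(n * R)) < iidLaw (P.map h) fun i => h (u i)) atTop (𝓝 0) :=
  tendsto_mass_lt_prod P (map_apply_pos P h) (by rwa [coe_entropy_map] at hR)

theorem tendsto_mass_iidLaw_lt_mul (P : PMF U) (h : U → V) {R : ℝ}
    (hR : condEntropy (P.map fun u => (u, h u)) < R) :
    Tendsto (fun n : ℕ => mass (iidLaw P : (Fin n → U) → ℝ)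
      fun u => iidLaw P u < (2 : ℝ) ^ (-(n * R)) * iidLaw (P.map h) fun i => h (u i))
      atTop (𝓝 0) := by
  refine squeeze_zero (fun n => mass_nonneg (isLaw_iidLaw P n) _) (fun n => ?_)
    (tendsto_mass_prod_lt P (condProb_pos P h) (by rwa [coe_condEntropy_map] at hR))
  refine mass_mono (isLaw_iidLaw P n) fun u hu hlt => ?_
  rwa [iidLaw_div_iidLaw_map, div_lt_iff₀ (iidLaw_map_pos P h hu)]

theorem tendsto_mass_mul_lt_iidLaw (P : PMF U) (h : U → V) {R : ℝ}
    (hR : R < condEntropy (P.map fun u => (u, h u))) :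
    Tendsto (fun n : ℕ => mass (iidLaw P : (Fin n → U) → ℝ)
      fun u => (2 : ℝ) ^ (-(n * R)) * iidLaw (P.map h) (fun i => h (u i)) < iidLaw P u)
      atTop (𝓝 0) := by
  refine squeeze_zero (fun n => mass_nonneg (isLaw_iidLaw P n) _) (fun n => ?_)
    (tendsto_mass_lt_prod P (condProb_pos P h) (by rwa [coe_condEntropy_map] at hR))
  refine mass_mono (isLaw_iidLaw P n) fun u hu hlt => ?_
  rwa [iidLaw_div_iidLaw_map, lt_div_iff₀ (iidLaw_map_pos P h hu)]

end Equipartition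

/-! ### Block uses of the channel -/

section Block

variable {X₁ X₂ Y₁ Y₂ : Type*} [Fintype Y₁] [Fintype Y₂]

theorem blockLaw_nonneg {X₁ X₂ Y₁ Y₂ : Type*} (W : Channel X₁ X₂ Y₁ Y₂) {n : ℕ} (x₁ : Fin n → X₁)
    (x₂ : Fin n → X₂) (y₁ : Fin n → Y₁) (y₂ : Fin n → Y₂) : 0 ≤ blockLaw W x₁ x₂ y₁ y₂ :=
  Finset.prod_nonneg fun _ _ => ENNReal.toReal_nonneg

theorem sum_blockLaw (W : Channel X₁ X₂ Y₁ Y₂) {n : ℕ} (x₁ : Fin n → X₁) (x₂ : Fin n → X₂) :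
    ∑ y₁ : Fin n → Y₁, ∑ y₂ : Fin n → Y₂, blockLaw W x₁ x₂ y₁ y₂ = 1 := by
  have h1 : ∀ y₁ : Fin n → Y₁, ∑ y₂ : Fin n → Y₂, blockLaw W x₁ x₂ y₁ y₂ =
      ∏ i, ∑ b, (W (x₁ i) (x₂ i) (y₁ i, b)).toReal := fun y₁ =>
    sum_pi_prod fun i b => (W (x₁ i) (x₂ i) (y₁ i, b)).toReal
  simp only [h1]
  rw [sum_pi_prod fun i a => ∑ b, (W (x₁ i) (x₂ i) (a, b)).toReal]
  refine Finset.prod_eq_one fun i _ => ?_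
  rw [← Fintype.sum_prod_type fun y => (W (x₁ i) (x₂ i) y).toReal]
  exact (isLaw_pmf _).sum_eq_one

/-- The probability of an event about the outputs of the channel, given its inputs. -/
noncomputable def blockMass (W : Channel X₁ X₂ Y₁ Y₂) {n : ℕ} (x₁ : Fin n → X₁) (x₂ : Fin n → X₂)
    (p : (Fin n → Y₁) → (Fin n → Y₂) → Prop) : ℝ :=
  ∑ y₁ : Fin n → Y₁, ∑ y₂ : Fin n → Y₂, blockLaw W x₁ x₂ y₁ y₂ * if p y₁ y₂ then 1 else 0

theorem blockMass_nonneg (W : Channel X₁ X₂ Y₁ Y₂) {n : ℕ} (x₁ : Fin n → X₁) (x₂ : Fin n → X₂)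
    (p : (Fin n → Y₁) → (Fin n → Y₂) → Prop) : 0 ≤ blockMass W x₁ x₂ p :=
  Finset.sum_nonneg fun y₁ _ => Finset.sum_nonneg fun y₂ _ =>
    mul_nonneg (blockLaw_nonneg W x₁ x₂ y₁ y₂) (by split_ifs <;> norm_num)

theorem blockMass_le_one (W : Channel X₁ X₂ Y₁ Y₂) {n : ℕ} (x₁ : Fin n → X₁) (x₂ : Fin n → X₂)
    (p : (Fin n → Y₁) → (Fin n → Y₂) → Prop) : blockMass W x₁ x₂ p ≤ 1 := by
  rw [← sum_blockLaw W x₁ x₂]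
  refine Finset.sum_le_sum fun y₁ _ => Finset.sum_le_sum fun y₂ _ => ?_
  refine mul_le_of_le_one_right (blockLaw_nonneg W x₁ x₂ y₁ y₂) ?_
  split_ifs <;> norm_num

/-- A union bound in which two of the events do not depend on the outputs. -/
theorem blockMass_le_add (W : Channel X₁ X₂ Y₁ Y₂) {n : ℕ} (x₁ : Fin n → X₁) (x₂ : Fin n → X₂)
    {p q : (Fin n → Y₁) → (Fin n → Y₂) → Prop} {b₁ b₂ : Prop}
    (h : ¬ b₁ → ¬ b₂ → ∀ y₁ y₂, p y₁ y₂ → q y₁ y₂) :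
    blockMass W x₁ x₂ p ≤
      blockMass W x₁ x₂ q + (if b₁ then 1 else 0) + if b₂ then 1 else 0 := by
  have hp := blockMass_le_one W x₁ x₂ p
  have hq := blockMass_nonneg W x₁ x₂ q
  by_cases h₁ : b₁
  · rw [if_pos h₁]
    split_ifs <;> linarith
  by_cases h₂ : b₂
  · rw [if_neg h₁, if_pos h₂]
    linarith
  rw [if_neg h₁, if_neg h₂, add_zero, add_zero]
  refine Finset.sum_le_sum fun y₁ _ => Finset.sum_le_sum fun y₂ _ => ?_
  refine mul_le_mul_of_nonneg_left ?_ (blockLaw_nonneg W x₁ x₂ y₁ y₂)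
  have := h h₁ h₂ y₁ y₂
  by_cases hpy : p y₁ y₂
  · simp [hpy, this hpy]
  · simp only [hpy, if_false]
    split_ifs <;> norm_num

/-- The error probability of a source code, given the source sequences. -/
noncomputable def SourceCode.blockError {U₁ V₁ U₂ V₂ : Type*} {n : ℕ}
    (c : SourceCode U₁ V₁ U₂ V₂ X₁ X₂ Y₁ Y₂ n) (W : Channel X₁ X₂ Y₁ Y₂) (h₁ : U₁ → V₁)
    (h₂ : U₂ → V₂) (u : (Fin n → U₁) × (Fin n → U₂)) : ℝ :=
  blockMass W (c.enc₁ u.1) (c.enc₂ u.2) fun y₁ y₂ =>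
    c.dec₁ y₁ (fun i => h₂ (u.2 i)) ≠ u.1 ∨ c.dec₂ y₂ (fun i => h₁ (u.1 i)) ≠ u.2

theorem SourceCode.errorProb_eq {U₁ V₁ U₂ V₂ : Type*} [Fintype U₁] [Fintype U₂] {n : ℕ}
    (c : SourceCode U₁ V₁ U₂ V₂ X₁ X₂ Y₁ Y₂ n) (W : Channel X₁ X₂ Y₁ Y₂)
    (P₁ : PMF U₁) (P₂ : PMF U₂) (h₁ : U₁ → V₁) (h₂ : U₂ → V₂) :
    c.errorProb W P₁ P₂ h₁ h₂ = ∑ u : (Fin n → U₁) × (Fin n → U₂),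
      iidLaw P₁ u.1 * iidLaw P₂ u.2 * c.blockError W h₁ h₂ u := by
  rw [Fintype.sum_prod_type]
  unfold SourceCode.errorProb SourceCode.blockError blockMass
  congr!

/-- The error probability of a message code, given the messages. -/
noncomputable def MessageCode.blockError {n M₁s M₁p M₂s M₂p : ℕ}
    (c : MessageCode X₁ X₂ Y₁ Y₂ n M₁s M₁p M₂s M₂p) (W : Channel X₁ X₂ Y₁ Y₂)
    (m : (Fin M₁s × Fin M₁p) × (Fin M₂s × Fin M₂p)) : ℝ :=
  blockMass W (c.enc₁ m.1) (c.enc₂ m.2) fun y₁ y₂ =>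
    c.dec₁ y₁ m.2.1 ≠ m.1 ∨ c.dec₂ y₂ m.1.1 ≠ m.2

theorem MessageCode.card_mul_errorProb {n M₁s M₁p M₂s M₂p : ℕ} [NeZero M₁s] [NeZero M₁p]
    [NeZero M₂s] [NeZero M₂p] (c : MessageCode X₁ X₂ Y₁ Y₂ n M₁s M₁p M₂s M₂p)
    (W : Channel X₁ X₂ Y₁ Y₂) :
    Fintype.card ((Fin M₁s × Fin M₁p) × (Fin M₂s × Fin M₂p)) * c.errorProb W =
      ∑ m, c.blockError W m := by
  have h : c.errorProb W = 1 / ((M₁s : ℝ) * M₁p * M₂s * M₂p) * ∑ m, c.blockError W m := by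
    rw [Fintype.sum_prod_type]
    unfold MessageCode.errorProb MessageCode.blockError blockMass
    congr!
  have h0 : (M₁s : ℝ) * M₁p * M₂s * M₂p ≠ 0 := by
    have := NeZero.ne M₁s
    have := NeZero.ne M₁p
    have := NeZero.ne M₂s
    have := NeZero.ne M₂p
    positivity
  rw [h, ← mul_assoc]
  simp only [Fintype.card_prod, Fintype.card_fin, Nat.cast_mul]
  rw [← mul_assoc ((M₁s : ℝ) * M₁p), mul_one_div_cancel h0, one_mul]

end Block

/-! ### Encoding a source with distributed indices -/

section SourceEncoding

variable {A B : Type*}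

/-- Elements of weight at least `c / M` and total weight at most `c` number at most `M`. -/
theorem exists_injOn_fin {M : ℕ} [NeZero M] {T : Finset A} {q : A → ℝ} {c : ℝ} (hc : 0 < c)
    (hsum : ∑ a ∈ T, q a ≤ c) (hT : ∀ a ∈ T, c ≤ q a * M) :
    ∃ s : A → Fin M, Set.InjOn s T := by
  have hcard : T.card ≤ M := by
    have h1 : T.card * c ≤ M * c := calc
      T.card * c = ∑ _a ∈ T, c := by simp
      _ ≤ ∑ a ∈ T, q a * M := Finset.sum_le_sum hT
      _ = M * ∑ a ∈ T, q a := by rw [← Finset.sum_mul, mul_comm]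
      _ ≤ M * c := by gcongr
    exact_mod_cast le_of_mul_le_mul_right h1 hc
  refine ⟨fun a => if h : a ∈ T then Fin.castLE hcard (T.equivFin ⟨a, h⟩) else 0, ?_⟩
  intro a ha b hb hab
  have ha' : a ∈ T := ha
  have hb' : b ∈ T := hb
  simp only [ha', hb', dif_pos] at hab
  have := T.equivFin.injective (Fin.castLE_injective hcard hab)
  simpa using this

/-- An encoding of `a` by an index of `h a` and a second index: decoding fails only if `h a` or,
given `h a`, the value `a` is improbable. -/
theorem exists_source_encoding [Fintype A] [Fintype B] {w : A → ℝ} (hw : IsLaw w) (h : A → B) (M N : ℕ)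
    [NeZero M] [NeZero N] :
    ∃ (s : B → Fin M) (p : A → Fin N) (d : Fin M × Fin N → A), ∀ a, d (s (h a), p a) ≠ a →
      marginal w h (h a) * M < 1 ∨ w a * N < marginal w h (h a) := by
  have hq := isLaw_marginal hw h
  obtain ⟨s, hs⟩ := exists_injOn_fin (M := M) (T := Finset.univ.filter fun b =>
    1 ≤ marginal w h b * M) (q := marginal w h) one_pos
    (hq.sum_eq_one ▸ Finset.sum_le_univ_sum_of_nonneg hq.nonneg) (by simp)
  -- Second indices are reused across fibres of `h`. A fibre of mass zero is excluded: there the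
  -- threshold is vacuous and gives no bound on the number of elements.
  have hp : ∀ b, ∃ p : A → Fin N, 0 < marginal w h b →
      Set.InjOn p {a | h a = b ∧ marginal w h b ≤ w a * N} := by
    intro b
    by_cases hb : 0 < marginal w h b
    · obtain ⟨p, hp⟩ := exists_injOn_fin (M := N) (T := Finset.univ.filter fun a =>
        h a = b ∧ marginal w h b ≤ w a * N) (q := w) hb (by
          rw [marginal, ← Finset.sum_filter]
          refine Finset.sum_le_sum_of_subset_of_nonneg ?_ fun a _ _ => hw.nonneg a
          intro a
          simp +contextual) (by simp)
      exact ⟨p, fun _ => by simpa using hp⟩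
    · exact ⟨fun _ => 0, fun h => absurd h hb⟩
  choose p hp using hp
  have := hw.nonempty
  set G : Set A := {a | 1 ≤ marginal w h (h a) * M ∧ marginal w h (h a) ≤ w a * N}
  set e : A → Fin M × Fin N := fun a => (s (h a), p (h a) a)
  have he : Set.InjOn e G := by
    intro a ha b hb hab
    obtain ⟨h1, h2⟩ := Prod.ext_iff.1 hab
    have h3 : h a = h b := hs (by simpa using ha.1) (by simpa using hb.1) h1
    simp only [e, ← h3] at h2
    have hpos : 0 < marginal w h (h a) := by
      by_contra! hle
      have := mul_nonpos_of_nonpos_of_nonneg hle (Nat.cast_nonneg (α := ℝ) M)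
      linarith [ha.1]
    exact hp (h a) hpos ⟨rfl, ha.2⟩ ⟨h3.symm, by simpa only [h3] using hb.2⟩ h2
  refine ⟨s, fun a => p (h a) a, Function.invFunOn e G, fun a ha => ?_⟩
  by_contra! hG
  exact ha (he.leftInvOn_invFunOn hG)

end SourceEncoding

/-! ### Sizes of message sets -/

section Sizes

instance (n : ℕ) (R : ℝ≥0) : NeZero (numMessages n R) :=
  ⟨(Nat.ceil_pos.2 (by positivity)).ne'⟩

theorem le_numMessages (n : ℕ) (R : ℝ≥0) :
    (2 : ℝ) ^ ((n : ℝ) * (R : ℝ)) ≤ numMessages n R := Nat.le_ceil _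

/-- Leaving out the message itself cancels the rounding up, so the number of competitors carries no
additive constant. -/
theorem numMessages_sub_one_le (n : ℕ) (R : ℝ≥0) :
    ((numMessages n R - 1 : ℕ) : ℝ) ≤ (2 : ℝ) ^ ((n : ℝ) * (R : ℝ)) := by
  have h1 : 1 ≤ numMessages n R := Nat.one_le_iff_ne_zero.2 (NeZero.ne _)
  rw [Nat.cast_sub h1, Nat.cast_one, sub_le_iff_le_add]
  exact (Nat.ceil_lt_add_one (by positivity)).le

theorem lt_rpow_neg_mul {q c x M : ℝ} (hq : 0 ≤ q) (hM : (2 : ℝ) ^ x ≤ M) (h : q * M < c) :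
    q < 2 ^ (-x) * c := by
  have h2 : (0 : ℝ) < 2 ^ x := by positivity
  rw [Real.rpow_neg zero_le_two, ← div_eq_inv_mul, lt_div_iff₀ h2]
  exact (mul_le_mul_of_nonneg_left hM hq).trans_lt h

/-- At rates above the entropies, the source sequences are recovered from their indices. -/
theorem exists_source_encoding_seq {U V : Type*} [Fintype U] [Fintype V] (P : PMF U) (h : U → V)
    {R R' : ℝ≥0} (hR : entropy (P.map h) < R) (hR' : condEntropy (P.map fun u => (u, h u)) < R') :
    ∃ (s : ∀ n, (Fin n → V) → Fin (numMessages n R)) (p : ∀ n, (Fin n → U) → Fin (numMessages n R'))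
      (d : ∀ n, Fin (numMessages n R) × Fin (numMessages n R') → (Fin n → U)),
      Tendsto (fun n => mass (iidLaw P : (Fin n → U) → ℝ)
        fun u => d n (s n fun i => h (u i), p n u) ≠ u) atTop (𝓝 0) := by
  choose s p d H using fun n : ℕ => exists_source_encoding (isLaw_iidLaw P n)
    (fun u i => h (u i)) (numMessages n R) (numMessages n R')
  refine ⟨s, p, d, ?_⟩
  have hlim := (tendsto_mass_iidLaw_map_lt P h (NNReal.coe_lt_coe.2 hR)).add
    (tendsto_mass_iidLaw_lt_mul P h (NNReal.coe_lt_coe.2 hR'))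
  rw [add_zero] at hlim
  refine squeeze_zero (fun n => mass_nonneg (isLaw_iidLaw P n) _) (fun n => ?_) hlim
  refine le_trans (mass_mono (isLaw_iidLaw P n) fun u _ hu => ?_) (mass_or_le (isLaw_iidLaw P n) _ _)
  have := H n u hu
  rw [marginal_iidLaw] at this
  refine this.imp (fun h1 => ?_) fun h1 => ?_
  · simpa using lt_rpow_neg_mul ((isLaw_iidLaw (P.map h) n).nonneg _) (le_numMessages n R) h1
  · exact lt_rpow_neg_mul ((isLaw_iidLaw P n).nonneg _) (le_numMessages n R') h1

/-- The expected number of collisions vanishes at rates below the entropy, and at rate zero. -/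
theorem exists_tendsto_numMessages_sub_one_mul {R H : ℝ≥0} (hR : R < H ∨ R = 0) :
    ∃ R' : ℝ, R' < H ∧ Tendsto (fun n : ℕ => ((numMessages n R - 1 : ℕ) : ℝ) *
      (2 : ℝ) ^ (-(n * R'))) atTop (𝓝 0) := by
  rcases hR with hR | rfl
  · have hR' : (R : ℝ) < H := hR
    -- The midpoint leaves a gap of `(H - R) / 2` on each side: one for equipartition, one for
    -- geometric decay.
    refine ⟨(R + H) / 2, by linarith, ?_⟩
    have hlt : (2 : ℝ) ^ ((R - H : ℝ) / 2) < 1 :=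
      Real.rpow_lt_one_of_one_lt_of_neg one_lt_two (by linarith)
    refine squeeze_zero (fun n => by positivity) (fun n => ?_)
      (tendsto_pow_atTop_nhds_zero_of_lt_one (by positivity) hlt)
    refine (mul_le_mul_of_nonneg_right (numMessages_sub_one_le n R) (by positivity)).trans ?_
    rw [← Real.rpow_add zero_lt_two, ← Real.rpow_natCast, ← Real.rpow_mul zero_le_two]
    exact le_of_eq (by ring_nf)
  -- At rate zero there is a single message and hence no competitor, so any exponent works; a
  -- negative one lies below `H` even when `H = 0`.
  · refine ⟨-1, neg_one_lt_zero.trans_le H.2, ?_⟩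
    simp [numMessages]

end Sizes

/-! ### From message codes to source codes -/

section Direct

/-- Some shift of the indices makes the mean error at most the error under uniform indices. -/
theorem IsLaw.exists_shift_le {T A : Type*} [Fintype T] [AddGroup T] [Fintype A] {w : A → ℝ}
    (hw : IsLaw w) (e : A → T) (K : T → ℝ) {κ : ℝ} (hK : Fintype.card T * κ = ∑ t, K t) :
    ∃ t, ∑ a, w a * K (e a + t) ≤ κ := by
  obtain ⟨t, -, ht⟩ := Finset.exists_le_of_sum_le (s := (Finset.univ : Finset T))
    (f := fun t => ∑ a, w a * K (e a + t)) (g := fun _ => κ) ⟨0, Finset.mem_univ _⟩ (by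
      rw [Finset.sum_comm]
      -- For fixed `a`, the shifted index `e a + t` runs over the whole group once.
      have h1 : ∀ a, ∑ t, w a * K (e a + t) = w a * ∑ t, K t := fun a => by
        rw [← Finset.mul_sum]
        congr 1
        exact Equiv.sum_comp (Equiv.addLeft (e a)) K
      simp only [h1]
      rw [← Finset.sum_mul, hw.sum_eq_one, one_mul, ← hK]
      simp)
  exact ⟨t, ht⟩

variable {U₁ V₁ U₂ V₂ X₁ X₂ Y₁ Y₂ : Type*} [Fintype U₁] [Fintype U₂] [Fintype Y₁] [Fintype Y₂]

theorem mass_prod_fst {A B : Type*} [Fintype A] [Fintype B] (w₁ : A → ℝ) {w₂ : B → ℝ}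
    (hw₂ : IsLaw w₂) (p : A → Prop) :
    mass (fun x : A × B => w₁ x.1 * w₂ x.2) (fun x => p x.1) = mass w₁ p := by
  unfold mass
  rw [Fintype.sum_prod_type]
  refine Finset.sum_congr rfl fun a _ => ?_
  by_cases ha : p a
  · simp [ha, ← Finset.mul_sum, hw₂.sum_eq_one]
  · simp [ha]

theorem mass_prod_snd {A B : Type*} [Fintype A] [Fintype B] {w₁ : A → ℝ} (hw₁ : IsLaw w₁)
    (w₂ : B → ℝ) (p : B → Prop) :
    mass (fun x : A × B => w₁ x.1 * w₂ x.2) (fun x => p x.2) = mass w₂ p := by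
  unfold mass
  rw [Fintype.sum_prod_type_right]
  refine Finset.sum_congr rfl fun b _ => ?_
  by_cases hb : p b
  · simp [hb, ← Finset.sum_mul, hw₁.sum_eq_one]
  · simp [hb]

theorem sum_prod_law_mul_ite_add {A B : Type*} [Fintype A] [Fintype B] {w₁ : A → ℝ} {w₂ : B → ℝ}
    (hw₁ : IsLaw w₁) (hw₂ : IsLaw w₂) (f : A × B → ℝ) (b₁ : A → Prop) (b₂ : B → Prop) :
    ∑ x : A × B, w₁ x.1 * w₂ x.2 *
        (f x + (if b₁ x.1 then 1 else 0) + if b₂ x.2 then 1 else 0) =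
      ∑ x : A × B, w₁ x.1 * w₂ x.2 * f x + mass w₁ b₁ + mass w₂ b₂ := by
  rw [← mass_prod_fst w₁ hw₂ b₁, ← mass_prod_snd hw₁ w₂ b₂]
  simp only [mul_add, Finset.sum_add_distrib, mass]

/-- After a good shift the indices are sent as messages, and the receivers undo the shift. Beyond
the error of the message code, only source words not recoverable from their indices are lost. -/
theorem MessageCode.exists_sourceCode {n M₁s M₁p M₂s M₂p : ℕ} [NeZero M₁s] [NeZero M₁p]
    [NeZero M₂s] [NeZero M₂p] (c : MessageCode X₁ X₂ Y₁ Y₂ n M₁s M₁p M₂s M₂p)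
    (W : Channel X₁ X₂ Y₁ Y₂) (P₁ : PMF U₁) (P₂ : PMF U₂) (h₁ : U₁ → V₁) (h₂ : U₂ → V₂)
    (s₁ : (Fin n → V₁) → Fin M₁s) (p₁ : (Fin n → U₁) → Fin M₁p)
    (d₁ : Fin M₁s × Fin M₁p → (Fin n → U₁))
    (s₂ : (Fin n → V₂) → Fin M₂s) (p₂ : (Fin n → U₂) → Fin M₂p)
    (d₂ : Fin M₂s × Fin M₂p → (Fin n → U₂)) :
    ∃ c' : SourceCode U₁ V₁ U₂ V₂ X₁ X₂ Y₁ Y₂ n, c'.errorProb W P₁ P₂ h₁ h₂ ≤ c.errorProb W +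
      mass (iidLaw P₁) (fun u => d₁ (s₁ fun i => h₁ (u i), p₁ u) ≠ u) +
      mass (iidLaw P₂) (fun u => d₂ (s₂ fun i => h₂ (u i), p₂ u) ≠ u) := by
  set e₁ : (Fin n → U₁) → Fin M₁s × Fin M₁p := fun u => (s₁ fun i => h₁ (u i), p₁ u)
  set e₂ : (Fin n → U₂) → Fin M₂s × Fin M₂p := fun u => (s₂ fun i => h₂ (u i), p₂ u)
  have hl₁ := isLaw_iidLaw P₁ n
  have hl₂ := isLaw_iidLaw P₂ n
  obtain ⟨t, ht⟩ := (hl₁.prod hl₂).exists_shift_le (fun u => (e₁ u.1, e₂ u.2)) (c.blockError W)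
    (c.card_mul_errorProb W)
  set c' : SourceCode U₁ V₁ U₂ V₂ X₁ X₂ Y₁ Y₂ n :=
    { enc₁ := fun u => c.enc₁ (e₁ u + t.1)
      enc₂ := fun u => c.enc₂ (e₂ u + t.2)
      -- From `V₂` the receiver computes the shifted shared index of the other transmitter, which is
      -- the side information that `c` expects.
      dec₁ := fun y v => d₁ (c.dec₁ y (s₂ v + t.2.1) - t.1)
      dec₂ := fun y v => d₂ (c.dec₂ y (s₁ v + t.1.1) - t.2) }
  refine ⟨c', ?_⟩
  rw [c'.errorProb_eq]
  obtain ⟨b₁, hB₁⟩ : ∃ b : (Fin n → U₁) → Prop, b = fun u => d₁ (e₁ u) ≠ u := ⟨_, rfl⟩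
  obtain ⟨b₂, hB₂⟩ : ∃ b : (Fin n → U₂) → Prop, b = fun u => d₂ (e₂ u) ≠ u := ⟨_, rfl⟩
  have hpt : ∀ u : (Fin n → U₁) × (Fin n → U₂), c'.blockError W h₁ h₂ u ≤
      c.blockError W ((e₁ u.1, e₂ u.2) + t) + (if b₁ u.1 then 1 else 0) +
        if b₂ u.2 then 1 else 0 := by
    intro u
    refine blockMass_le_add W _ _ fun hb₁ hb₂ y₁ y₂ hy => ?_
    rw [hB₁, not_not] at hb₁
    rw [hB₂, not_not] at hb₂
    refine hy.imp (fun hy h => hy ?_) fun hy h => hy ?_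
    · change d₁ (c.dec₁ y₁ ((e₁ u.1, e₂ u.2) + t).2.1 - t.1) = u.1
      rw [h, Prod.fst_add, add_sub_cancel_right, hb₁]
    · change d₂ (c.dec₂ y₂ ((e₁ u.1, e₂ u.2) + t).1.1 - t.2) = u.2
      rw [h, Prod.snd_add, add_sub_cancel_right, hb₂]
  refine (Finset.sum_le_sum fun u _ =>
    mul_le_mul_of_nonneg_left (hpt u) ((hl₁.prod hl₂).nonneg u)).trans ?_
  rw [sum_prod_law_mul_ite_add hl₁ hl₂ fun u => c.blockError W ((e₁ u.1, e₂ u.2) + t), hB₁, hB₂]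
  exact add_le_add (add_le_add ht le_rfl) le_rfl

theorem SourceCode.errorProb_nonneg {n : ℕ} (c : SourceCode U₁ V₁ U₂ V₂ X₁ X₂ Y₁ Y₂ n)
    (W : Channel X₁ X₂ Y₁ Y₂) (P₁ : PMF U₁) (P₂ : PMF U₂) (h₁ : U₁ → V₁) (h₂ : U₂ → V₂) :
    0 ≤ c.errorProb W P₁ P₂ h₁ h₂ := by
  rw [c.errorProb_eq]
  exact Finset.sum_nonneg fun u _ => mul_nonneg
    (((isLaw_iidLaw P₁ n).prod (isLaw_iidLaw P₂ n)).nonneg u) (blockMass_nonneg ..)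

/-- Sources with entropies below achievable rates can be transmitted. -/
theorem Achievable.reliablyTransmissible [Fintype V₁] [Fintype V₂] {W : Channel X₁ X₂ Y₁ Y₂}
    {R₁s R₁p R₂s R₂p : ℝ≥0} (hR : Achievable W (R₁s, R₁p, R₂s, R₂p))
    {P₁ : PMF U₁} {P₂ : PMF U₂} {h₁ : U₁ → V₁} {h₂ : U₂ → V₂}
    (h₁s : entropy (P₁.map h₁) < R₁s) (h₁p : condEntropy (P₁.map fun u => (u, h₁ u)) < R₁p)
    (h₂s : entropy (P₂.map h₂) < R₂s) (h₂p : condEntropy (P₂.map fun u => (u, h₂ u)) < R₂p) :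
    ReliablyTransmissible W P₁ P₂ h₁ h₂ := by
  obtain ⟨c, hc⟩ := hR
  obtain ⟨s₁, p₁, d₁, hlim₁⟩ := exists_source_encoding_seq P₁ h₁ h₁s h₁p
  obtain ⟨s₂, p₂, d₂, hlim₂⟩ := exists_source_encoding_seq P₂ h₂ h₂s h₂p
  choose c' hc' using fun n => (c n).exists_sourceCode W P₁ P₂ h₁ h₂
    (s₁ n) (p₁ n) (d₁ n) (s₂ n) (p₂ n) (d₂ n)
  refine ⟨c', squeeze_zero (fun n => (c' n).errorProb_nonneg ..) hc' ?_⟩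
  simpa using (hc.add hlim₁).add hlim₂

end Direct

/-! ### Random codebooks -/

section Codebook

variable {A B : Type*} [Fintype A]

/-- The conditional law of `a` given `h a = b`. -/
noncomputable def condLaw (w : A → ℝ) (h : A → B) (b : B) (a : A) : ℝ :=
  if marginal w h b = 0 then w a else if h a = b then w a / marginal w h b else 0

/-- The fallback to `w` at values of probability zero makes this a law for every `b`, as the
codebook has words for every `b`. -/
theorem isLaw_condLaw {w : A → ℝ} (hw : IsLaw w) (h : A → B) (b : B) : IsLaw (condLaw w h b) := by
  have hq : 0 ≤ marginal w h b :=
    Finset.sum_nonneg fun a _ => by split_ifs <;> simp [hw.nonneg a]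
  by_cases hb : marginal w h b = 0
  · have : condLaw w h b = w := by
      ext a
      simp [condLaw, hb]
    rwa [this]
  · refine ⟨fun a => ?_, ?_⟩
    · unfold condLaw
      have := hw.nonneg a
      split_ifs <;> positivity
    · calc ∑ a, condLaw w h b a = ∑ a, (if h a = b then w a else 0) / marginal w h b := by
            refine Finset.sum_congr rfl fun a _ => ?_
            simp only [condLaw, hb, if_false]
            split_ifs <;> simp
        _ = 1 := by
            rw [← Finset.sum_div]
            exact div_self hb

theorem marginal_mul_condLaw {w : A → ℝ} (hw : IsLaw w) (h : A → B) (b : B) (a : A) :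
    marginal w h b * condLaw w h b a = if h a = b then w a else 0 := by
  by_cases hb : marginal w h b = 0
  · rw [hb, zero_mul]
    split_ifs with ha
    · have := hw.le_marginal h a
      rw [ha, hb] at this
      exact le_antisymm (hw.nonneg a) this
    · rfl
  · simp only [condLaw, hb, if_false]
    split_ifs
    · field_simp
    · simp

variable [Fintype B]

theorem sum_marginal_mul_sum_condLaw_mul {w : A → ℝ} (hw : IsLaw w) (h : A → B) (f : B → A → ℝ) :
    ∑ b, marginal w h b * ∑ a, condLaw w h b a * f b a = ∑ a, w a * f (h a) a := by
  simp only [Finset.mul_sum, ← mul_assoc, marginal_mul_condLaw hw]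
  rw [Finset.sum_comm]
  simp

/-- The law of a random codebook: `M` independent words `ω.1 s` of law `marginal w h`, and `N`
independent words `ω.2 (p, b)` for every `b`, of law `condLaw w h b`. -/
noncomputable def codebookLaw (w : A → ℝ) (h : A → B) (M N : ℕ)
    (ω : (Fin M → B) × (Fin N × B → A)) : ℝ :=
  piLaw (fun _ => marginal w h) ω.1 * piLaw (fun k => condLaw w h k.2) ω.2

/-- The codeword of a message. -/
def codeword {M N : ℕ} (ω : (Fin M → B) × (Fin N × B → A)) (m : Fin M × Fin N) : A :=
  ω.2 (m.2, ω.1 m.1)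

theorem isLaw_codebookLaw {w : A → ℝ} (hw : IsLaw w) (h : A → B) (M N : ℕ) :
    IsLaw (codebookLaw w h M N) :=
  (isLaw_piLaw fun _ => isLaw_marginal hw h).prod (isLaw_piLaw fun k => isLaw_condLaw hw h k.2)

/-- Drawing `b` from the marginal and then `a` from the conditional law reproduces `w`. Private
words are indexed by the value `b`, not by the shared message, so the two layers of the codebook are
independent. -/
theorem sum_codebookLaw_mul {w : A → ℝ} (hw : IsLaw w) (h : A → B) {M N : ℕ} (m : Fin M × Fin N)
    (f : A → ℝ) :
    ∑ ω, codebookLaw w h M N ω * f (codeword ω m) = ∑ a, w a * f a := by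
  rw [Fintype.sum_prod_type]
  simp only [codebookLaw, codeword, mul_assoc, ← Finset.mul_sum]
  have h1 : ∀ v : Fin M → B, ∑ z : Fin N × B → A, piLaw (fun k => condLaw w h k.2) z *
      f (z (m.2, v m.1)) = ∑ a, condLaw w h (v m.1) a * f a := fun v =>
    sum_piLaw_mul (w := fun k : Fin N × B => condLaw w h k.2)
      (fun k => isLaw_condLaw hw h k.2) (m.2, v m.1) f
  simp only [h1]
  rw [sum_piLaw_mul (fun _ => isLaw_marginal hw h) m.1 fun b => ∑ a, condLaw w h b a * f a]
  exact sum_marginal_mul_sum_condLaw_mul hw h fun _ => f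

/-- True only almost surely. It makes the `V`-word of a codeword a function of the shared message
alone, so a receiver knowing that message knows the side information. -/
theorem apply_codeword {w : A → ℝ} {h : A → B} {M N : ℕ}
    {ω : (Fin M → B) × (Fin N × B → A)} (hω : codebookLaw w h M N ω ≠ 0) (m : Fin M × Fin N) :
    h (codeword ω m) = ω.1 m.1 := by
  have h1 : marginal w h (ω.1 m.1) ≠ 0 := fun h0 =>
    left_ne_zero_of_mul hω (Finset.prod_eq_zero (Finset.mem_univ m.1) h0)
  have h2 : condLaw w h (ω.1 m.1) (codeword ω m) ≠ 0 := fun h0 =>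
    right_ne_zero_of_mul hω (Finset.prod_eq_zero (Finset.mem_univ (m.2, ω.1 m.1)) h0)
  by_contra hne
  simp [condLaw, h1, hne] at h2

/-- The word `x m` is shared with another message. -/
def Collides {S A : Type*} (x : S → A) (m : S) : Prop := ∃ m', m' ≠ m ∧ x m' = x m

/-- The probability that the codeword of a message is shared with another message. -/
noncomputable def collisionProb (w : A → ℝ) (h : A → B) {M N : ℕ} (m : Fin M × Fin N) : ℝ :=
  mass (codebookLaw w h M N) fun ω => Collides (codeword ω) m

theorem collisionProb_le {w : A → ℝ} (hw : IsLaw w) (h : A → B) {M N : ℕ}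
    (m : Fin M × Fin N) {β β' : ℝ} (hβ : 0 ≤ β) (hβ' : 0 ≤ β') :
    collisionProb w h m ≤
      (mass w (fun a => β < marginal w h (h a)) + (M - 1 : ℕ) * β) +
        (mass w (fun a => β' * marginal w h (h a) < w a) + (N - 1 : ℕ) * β') := by
  have hL := isLaw_codebookLaw hw h M N
  have hq : ∀ _ : Fin M, IsLaw (marginal w h) := fun _ => isLaw_marginal hw h
  have hc : ∀ k : Fin N × B, IsLaw (condLaw w h k.2) := fun k => isLaw_condLaw hw h k.2
  set J : (Fin M → B) → Finset (Fin N × B) := fun v =>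
    (Finset.univ.erase m.2).image fun p => (p, v m.1)
  have hmono : mass (codebookLaw w h M N)
      (fun ω => Collides (codeword ω) m) ≤ mass (codebookLaw w h M N)
      (fun ω => (∃ s ∈ Finset.univ.erase m.1, ω.1 s = ω.1 m.1) ∨
        ∃ k ∈ J ω.1, ω.2 k = ω.2 (m.2, ω.1 m.1)) := by
    refine mass_mono hL fun ω hω => ?_
    rintro ⟨m', hne, heq⟩
    -- Equal codewords have equal cloud centres. So either two distinct shared messages collide, or
    -- the shared messages agree and two private words around the same centre collide.
    have hv : ω.1 m'.1 = ω.1 m.1 := by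
      rw [← apply_codeword hω m', ← apply_codeword hω m, heq]
    by_cases hs : m'.1 = m.1
    · refine Or.inr ⟨(m'.2, ω.1 m.1), Finset.mem_image.2 ⟨m'.2, ?_, rfl⟩, ?_⟩
      · simpa using fun h2 => hne (Prod.ext hs h2)
      · rw [← hv]
        rw [codeword, codeword, hv] at heq
        rw [hv, heq]
    · exact Or.inl ⟨m'.1, by simpa using hs, hv⟩
  refine (hmono.trans (mass_or_le hL _ _)).trans (add_le_add ?_ ?_)
  · refine (le_of_eq (mass_prod_fst _ (isLaw_piLaw hc)
      fun v : Fin M → B => ∃ s ∈ Finset.univ.erase m.1, v s = v m.1)).trans ?_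
    refine (mass_piLaw_collision_le hq (Finset.notMem_erase _ _) (fun _ _ => rfl) hβ).trans ?_
    rw [Finset.card_erase_of_mem (Finset.mem_univ _), Finset.card_univ, Fintype.card_fin]
    refine add_le_add (le_of_eq ?_) le_rfl
    exact sum_marginal_mul w h fun b => if β < marginal w h b then 1 else 0
  · have hJ : ∀ v, mass (piLaw fun k : Fin N × B => condLaw w h k.2)
        (fun z => ∃ k ∈ J v, z k = z (m.2, v m.1)) ≤
        mass (condLaw w h (v m.1)) (fun a => β' < condLaw w h (v m.1) a) + (N - 1 : ℕ) * β' := by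
      intro v
      refine (mass_piLaw_collision_le hc (i := (m.2, v m.1)) (by simp [J]) (fun k hk => ?_)
        hβ').trans (add_le_add le_rfl (mul_le_mul_of_nonneg_right ?_ hβ'))
      · obtain ⟨p, -, rfl⟩ := Finset.mem_image.1 hk
        rfl
      · refine Nat.cast_le.2 (Finset.card_image_le.trans ?_)
        rw [Finset.card_erase_of_mem (Finset.mem_univ _), Finset.card_univ, Fintype.card_fin]
    -- Conditionally on the centres `v`, the private words around `v m.1` are still independent with
    -- a common law, so `hJ` applies to each `v`.
    calc mass (codebookLaw w h M N) (fun ω => ∃ k ∈ J ω.1, ω.2 k = ω.2 (m.2, ω.1 m.1))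
        = ∑ v, piLaw (fun _ : Fin M => marginal w h) v *
          mass (piLaw fun k : Fin N × B => condLaw w h k.2)
            (fun z => ∃ k ∈ J v, z k = z (m.2, v m.1)) := by
          unfold mass codebookLaw
          rw [Fintype.sum_prod_type]
          simp only [mul_assoc, ← Finset.mul_sum]
      _ ≤ ∑ v, piLaw (fun _ : Fin M => marginal w h) v *
          (mass (condLaw w h (v m.1)) (fun a => β' < condLaw w h (v m.1) a) +
            (N - 1 : ℕ) * β') :=
          Finset.sum_le_sum fun v _ => mul_le_mul_of_nonneg_left (hJ v) ((isLaw_piLaw hq).nonneg v)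
      _ = ∑ b, marginal w h b * mass (condLaw w h b) (fun a => β' < condLaw w h b a) +
          (N - 1 : ℕ) * β' := by
          simp only [mul_add, Finset.sum_add_distrib]
          rw [sum_piLaw_mul hq m.1
            fun b => mass (condLaw w h b) (fun a => β' < condLaw w h b a), ← Finset.sum_mul,
            (isLaw_piLaw hq).sum_eq_one, one_mul]
      _ = mass w (fun a => β' < condLaw w h (h a) a) + (N - 1 : ℕ) * β' := by
          congr 1
          exact sum_marginal_mul_sum_condLaw_mul hw h
            fun b a => if β' < condLaw w h b a then 1 else 0
      _ ≤ _ := by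
          refine add_le_add (mass_mono hw fun a ha hlt => ?_) le_rfl
          have hpos : 0 < marginal w h (h a) :=
            ((hw.nonneg a).lt_of_ne' ha).trans_le (hw.le_marginal h a)
          simp only [condLaw, hpos.ne', if_false, if_true] at hlt
          exact (lt_div_iff₀ hpos).1 hlt

theorem IsLaw.exists_sum_le {Ω T : Type*} [Fintype Ω] [Fintype T] {w : Ω → ℝ} (hw : IsLaw w)
    (f : Ω → T → ℝ) {κ : ℝ} (hf : ∀ m, ∑ ω, w ω * f ω m ≤ κ) :
    ∃ ω, w ω ≠ 0 ∧ ∑ m, f ω m ≤ Fintype.card T * κ := by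
  obtain ⟨ω, h0, hω⟩ := hw.exists_le_mean fun ω => ∑ m, f ω m
  refine ⟨ω, h0, hω.trans ?_⟩
  simp only [Finset.mul_sum]
  rw [Finset.sum_comm]
  exact (Finset.sum_le_sum fun m _ => hf m).trans (by simp)

/-- A pair of codebooks that is no worse than the mean over random codebooks. -/
theorem exists_codebooks {A₁ B₁ A₂ B₂ : Type*} [Fintype A₁] [Fintype B₁] [Fintype A₂] [Fintype B₂]
    {w₁ : A₁ → ℝ} {w₂ : A₂ → ℝ} (hw₁ : IsLaw w₁) (hw₂ : IsLaw w₂) (h₁ : A₁ → B₁) (h₂ : A₂ → B₂)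
    {M₁ N₁ M₂ N₂ : ℕ} (K : A₁ × A₂ → ℝ) {γ₁ γ₂ : ℝ}
    (hγ₁ : ∀ m : Fin M₁ × Fin N₁, collisionProb w₁ h₁ m ≤ γ₁)
    (hγ₂ : ∀ m : Fin M₂ × Fin N₂, collisionProb w₂ h₂ m ≤ γ₂) :
    ∃ (v₁ : Fin M₁ → B₁) (x₁ : Fin M₁ × Fin N₁ → A₁) (v₂ : Fin M₂ → B₂)
      (x₂ : Fin M₂ × Fin N₂ → A₂), (∀ m, h₁ (x₁ m) = v₁ m.1) ∧ (∀ m, h₂ (x₂ m) = v₂ m.1) ∧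
      ∑ m : (Fin M₁ × Fin N₁) × (Fin M₂ × Fin N₂), (K (x₁ m.1, x₂ m.2) +
        (if Collides x₁ m.1 then 1 else 0) +
        if Collides x₂ m.2 then 1 else 0) ≤
      Fintype.card ((Fin M₁ × Fin N₁) × (Fin M₂ × Fin N₂)) *
        (∑ u : A₁ × A₂, w₁ u.1 * w₂ u.2 * K u + γ₁ + γ₂) := by
  have hL₁ := isLaw_codebookLaw hw₁ h₁ M₁ N₁
  have hL₂ := isLaw_codebookLaw hw₂ h₂ M₂ N₂
  obtain ⟨ω, h0, hω⟩ := (hL₁.prod hL₂).exists_sum_le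
    (T := (Fin M₁ × Fin N₁) × (Fin M₂ × Fin N₂))
    (fun ω m => K (codeword ω.1 m.1, codeword ω.2 m.2) +
      (if Collides (codeword ω.1) m.1 then 1 else 0) +
      if Collides (codeword ω.2) m.2 then 1 else 0)
    (κ := ∑ u : A₁ × A₂, w₁ u.1 * w₂ u.2 * K u + γ₁ + γ₂) (by
      intro m
      have := sum_prod_law_mul_ite_add hL₁ hL₂
        (fun ω => K (codeword ω.1 m.1, codeword ω.2 m.2))
        (fun ω => Collides (codeword ω) m.1)
        fun ω => Collides (codeword ω) m.2
      refine (le_of_eq this).trans (add_le_add (add_le_add (le_of_eq ?_) (hγ₁ _)) (hγ₂ _))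
      rw [Fintype.sum_prod_type (α₁ := (Fin M₁ → B₁) × (Fin N₁ × B₁ → A₁)),
        Fintype.sum_prod_type (α₁ := A₁)]
      simp only [mul_assoc, ← Finset.mul_sum]
      rw [← sum_codebookLaw_mul hw₁ h₁ m.1 fun u₁ => ∑ u₂, w₂ u₂ * K (u₁, u₂)]
      refine Finset.sum_congr rfl fun ω₁ _ => ?_
      rw [sum_codebookLaw_mul hw₂ h₂ m.2 fun u₂ => K (codeword ω₁ m.1, u₂)])
  -- The chosen codebooks have positive probability, which is what `apply_codeword` needs.
  exact ⟨ω.1.1, codeword ω.1, ω.2.1, codeword ω.2, apply_codeword (left_ne_zero_of_mul h0),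
    apply_codeword (right_ne_zero_of_mul h0), hω⟩

end Codebook

/-! ### From source codes to message codes -/

section Converse

variable {U₁ V₁ U₂ V₂ X₁ X₂ Y₁ Y₂ : Type*} [Fintype U₁] [Fintype V₁] [Fintype U₂] [Fintype V₂]
  [Fintype Y₁] [Fintype Y₂]

/-- Each receiver turns the known shared message into the `V`-word of the interferer, runs the
source decoder and inverts its own codebook; inversion of a correctly decoded word can fail only at
a shared codeword. -/
theorem SourceCode.exists_messageCode {n M₁s M₁p M₂s M₂p : ℕ} [NeZero M₁s] [NeZero M₁p]
    [NeZero M₂s] [NeZero M₂p] (c : SourceCode U₁ V₁ U₂ V₂ X₁ X₂ Y₁ Y₂ n)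
    (W : Channel X₁ X₂ Y₁ Y₂) (P₁ : PMF U₁) (P₂ : PMF U₂) (h₁ : U₁ → V₁) (h₂ : U₂ → V₂)
    {γ₁ γ₂ : ℝ}
    (hγ₁ : ∀ m : Fin M₁s × Fin M₁p,
      collisionProb (iidLaw P₁) (fun (u : Fin n → U₁) i => h₁ (u i)) m ≤ γ₁)
    (hγ₂ : ∀ m : Fin M₂s × Fin M₂p,
      collisionProb (iidLaw P₂) (fun (u : Fin n → U₂) i => h₂ (u i)) m ≤ γ₂) :
    ∃ c' : MessageCode X₁ X₂ Y₁ Y₂ n M₁s M₁p M₂s M₂p,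
      c'.errorProb W ≤ c.errorProb W P₁ P₂ h₁ h₂ + γ₁ + γ₂ := by
  obtain ⟨v₁, x₁, v₂, x₂, hx₁, hx₂, hsum⟩ := exists_codebooks (isLaw_iidLaw P₁ n)
    (isLaw_iidLaw P₂ n) _ _ (c.blockError W h₁ h₂) hγ₁ hγ₂
  rw [← c.errorProb_eq] at hsum
  set c' : MessageCode X₁ X₂ Y₁ Y₂ n M₁s M₁p M₂s M₂p :=
    { enc₁ := fun m => c.enc₁ (x₁ m)
      enc₂ := fun m => c.enc₂ (x₂ m)
      dec₁ := fun y s => Function.invFun x₁ (c.dec₁ y (v₂ s))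
      dec₂ := fun y s => Function.invFun x₂ (c.dec₂ y (v₁ s)) }
  refine ⟨c', ?_⟩
  have hcard : (0 : ℝ) < Fintype.card ((Fin M₁s × Fin M₁p) × (Fin M₂s × Fin M₂p)) :=
    Nat.cast_pos.2 Fintype.card_pos
  refine le_of_mul_le_mul_left ?_ hcard
  rw [c'.card_mul_errorProb]
  refine (Finset.sum_le_sum fun m _ => ?_).trans hsum
  refine blockMass_le_add W _ _ fun hb₁ hb₂ y₁ y₂ hy => ?_
  refine hy.imp (fun hy h => hy ?_) fun hy h => hy ?_
  · change Function.invFun x₁ (c.dec₁ y₁ (v₂ m.2.1)) = m.1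
    rw [← hx₂ m.2, h]
    by_contra hne
    exact hb₁ ⟨_, hne, Function.invFun_eq ⟨m.1, rfl⟩⟩
  · change Function.invFun x₂ (c.dec₂ y₂ (v₁ m.1.1)) = m.2
    rw [← hx₁ m.1, h]
    by_contra hne
    exact hb₂ ⟨_, hne, Function.invFun_eq ⟨m.2, rfl⟩⟩

/-- At rates below the entropies, collisions in the random codebook are improbable. -/
theorem exists_tendsto_collision_bound {U V : Type*} [Fintype U] [Fintype V] (P : PMF U)
    (h : U → V) {R R' : ℝ≥0} (hR : R < entropy (P.map h) ∨ R = 0)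
    (hR' : R' < condEntropy (P.map fun u => (u, h u)) ∨ R' = 0) :
    ∃ γ : ℕ → ℝ, Tendsto γ atTop (𝓝 0) ∧ ∀ n,
      ∀ m : Fin (numMessages n R) × Fin (numMessages n R'),
        collisionProb (iidLaw P) (fun (u : Fin n → U) i => h (u i)) m ≤ γ n := by
  obtain ⟨r, hr, hlim⟩ := exists_tendsto_numMessages_sub_one_mul hR
  obtain ⟨r', hr', hlim'⟩ := exists_tendsto_numMessages_sub_one_mul hR'
  refine ⟨_, ?_, fun n m => collisionProb_le (isLaw_iidLaw P n) _ m
    (β := 2 ^ (-(n * r))) (β' := 2 ^ (-(n * r'))) (by positivity) (by positivity)⟩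
  simp only [marginal_iidLaw]
  simpa using ((tendsto_mass_lt_iidLaw_map P h hr).add hlim).add
    ((tendsto_mass_mul_lt_iidLaw P h hr').add hlim')

theorem MessageCode.errorProb_nonneg {n M₁s M₁p M₂s M₂p : ℕ}
    (c : MessageCode X₁ X₂ Y₁ Y₂ n M₁s M₁p M₂s M₂p) (W : Channel X₁ X₂ Y₁ Y₂) :
    0 ≤ c.errorProb W :=
  mul_nonneg (by positivity) (Finset.sum_nonneg fun _ _ => Finset.sum_nonneg fun _ _ =>
    Finset.sum_nonneg fun _ _ => Finset.sum_nonneg fun _ _ =>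
      mul_nonneg (blockLaw_nonneg ..) (by split_ifs <;> norm_num))

/-- Rates below the entropies of transmissible sources are achievable. -/
theorem ReliablyTransmissible.achievable {W : Channel X₁ X₂ Y₁ Y₂}
    {P₁ : PMF U₁} {P₂ : PMF U₂} {h₁ : U₁ → V₁} {h₂ : U₂ → V₂}
    (hT : ReliablyTransmissible W P₁ P₂ h₁ h₂) {R₁s R₁p R₂s R₂p : ℝ≥0}
    (h₁s : R₁s < entropy (P₁.map h₁) ∨ R₁s = 0)
    (h₁p : R₁p < condEntropy (P₁.map fun u => (u, h₁ u)) ∨ R₁p = 0)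
    (h₂s : R₂s < entropy (P₂.map h₂) ∨ R₂s = 0)
    (h₂p : R₂p < condEntropy (P₂.map fun u => (u, h₂ u)) ∨ R₂p = 0) :
    Achievable W (R₁s, R₁p, R₂s, R₂p) := by
  obtain ⟨c, hc⟩ := hT
  obtain ⟨γ₁, hlim₁, hγ₁⟩ := exists_tendsto_collision_bound P₁ h₁ h₁s h₁p
  obtain ⟨γ₂, hlim₂, hγ₂⟩ := exists_tendsto_collision_bound P₂ h₂ h₂s h₂p
  choose c' hc' using fun n => (c n).exists_messageCode W P₁ P₂ h₁ h₂ (hγ₁ n) (hγ₂ n)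
  refine ⟨c', squeeze_zero (fun n => (c' n).errorProb_nonneg W) hc' ?_⟩
  simpa using (hc.add hlim₁).add hlim₂

end Converse

/-! ### The capacity region -/

section Region

open Set

theorem exists_mem_forall_lt {S : Set Rates} {a b c d : ℝ≥0}
    (h : (a, b, c, d) ∈ interior (closure S)) :
    ∃ a' b' c' d', (a', b', c', d') ∈ S ∧ a < a' ∧ b < b' ∧ c < c' ∧ d < d' := by
  have hcont : Continuous fun ε : ℝ≥0 => ((a + ε, b + ε, c + ε, d + ε) : Rates) := by fun_prop
  have hev : ∀ᶠ ε in 𝓝[>] (0 : ℝ≥0), ((a + ε, b + ε, c + ε, d + ε) : Rates) ∈ closure S := by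
    refine (hcont.tendsto 0).eventually_mem ?_ |>.filter_mono nhdsWithin_le_nhds
    simpa using mem_interior_iff_mem_nhds.1 h
  obtain ⟨ε, hε, hpos⟩ := (hev.and self_mem_nhdsWithin).exists
  have hpos' : 0 < ε := hpos
  -- The point moved up by `ε` is in the closure and in this open orthant, so the orthant meets `S`.
  have hopen : IsOpen (Ioi a ×ˢ Ioi b ×ˢ Ioi c ×ˢ Ioi d) :=
    isOpen_Ioi.prod (isOpen_Ioi.prod (isOpen_Ioi.prod isOpen_Ioi))
  obtain ⟨⟨a', b', c', d'⟩, ⟨ha, hb, hc, hd⟩, hS⟩ :=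
    mem_closure_iff.1 hε _ hopen (by simp [hpos'])
  exact ⟨a', b', c', d', hS, ha, hb, hc, hd⟩

/-- Scaling by `t < 1` decreases positive coordinates strictly and fixes zero ones; hence the
alternative `= 0`, as no rate lies below a vanishing entropy. -/
theorem mem_closure_of_forall_lt {S : Set Rates} {a b c d : ℝ≥0}
    (h : ∀ a' b' c' d' : ℝ≥0, (a' < a ∨ a' = 0) → (b' < b ∨ b' = 0) → (c' < c ∨ c' = 0) →
      (d' < d ∨ d' = 0) → (a', b', c', d') ∈ S) :
    (a, b, c, d) ∈ closure S := by
  have hcont : Continuous fun t : ℝ≥0 => ((t * a, t * b, t * c, t * d) : Rates) := by fun_prop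
  have hlim : Tendsto (fun t : ℝ≥0 => ((t * a, t * b, t * c, t * d) : Rates)) (𝓝[<] 1)
      (𝓝 (a, b, c, d)) := by
    simpa using (hcont.tendsto 1).mono_left nhdsWithin_le_nhds
  have : (𝓝[<] (1 : ℝ≥0)).NeBot := nhdsLT_neBot_of_exists_lt ⟨0, zero_lt_one⟩
  refine mem_closure_of_tendsto hlim (eventually_mem_nhdsWithin.mono fun t ht => ?_)
  have hmul : ∀ x : ℝ≥0, t * x < x ∨ t * x = 0 := fun x => by
    rcases eq_or_ne x 0 with rfl | hx
    · simp
    · exact Or.inl (mul_lt_of_lt_one_left (pos_iff_ne_zero.2 hx) ht)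
  exact h _ _ _ _ (hmul a) (hmul b) (hmul c) (hmul d)

end Region

end InterferenceChannel

theorem theorem3 {U₁ V₁ U₂ V₂ X₁ X₂ Y₁ Y₂ : Type*}
    [Fintype U₁] [Fintype V₁] [Fintype U₂] [Fintype V₂]
    [Fintype X₁] [Fintype X₂] [Fintype Y₁] [Fintype Y₂]
    (W : InterferenceChannel.Channel X₁ X₂ Y₁ Y₂)
    (P₁ : PMF U₁) (P₂ : PMF U₂) (h₁ : U₁ → V₁) (h₂ : U₂ → V₂) :
    (InterferenceChannel.entropyPoint P₁ P₂ h₁ h₂ ∈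
        interior (InterferenceChannel.capacityRegion W) →
      InterferenceChannel.ReliablyTransmissible W P₁ P₂ h₁ h₂) ∧
    (InterferenceChannel.entropyPoint P₁ P₂ h₁ h₂ ∉ InterferenceChannel.capacityRegion W →
      ¬ InterferenceChannel.ReliablyTransmissible W P₁ P₂ h₁ h₂) := by
  refine ⟨fun h => ?_, fun h hT => h ?_⟩
  · obtain ⟨R₁s, R₁p, R₂s, R₂p, hR, h₁s, h₁p, h₂s, h₂p⟩ :=
      InterferenceChannel.exists_mem_forall_lt h
    exact InterferenceChannel.Achievable.reliablyTransmissible hR h₁s h₁p h₂s h₂p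
  · exact InterferenceChannel.mem_closure_of_forall_lt fun _ _ _ _ h₁s h₁p h₂s h₂p =>
      hT.achievable h₁s h₁p h₂s h₂p
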